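/- Let $d\ge 1$ and let $e_1,e_2,\dots$ be the monomials $z^{\alpha}=z_1^{\alpha_1}\cdots z_d^{\alpha_d}$ on $\mathbb{C}^d$, listed with nondecreasing degree $|\alpha|=\alpha_1+\cdots+\alpha_d$ and lexicographically within each degree. Let $m_n$ be the number of monomials of degree at most $n$ and $l_n=\sum_{j=1}^{m_n}\deg e_j$. For compact nonempty $E\subset\mathbb{C}^d$ and $n\ge 1$ put $$\delta_n(E)=\Bigl(\max_{\zeta_1,\dots,\zeta_{m_n}\in E}\bigl|\det[e_i(\zeta_j)]_{i,j=1,\dots,m_n}\bigr|\Bigr)^{1/l_n},\qquad \delta(E)=\lim_{n\to\infty}\delta_n(E),$$ where $\delta(E)$ is called the transfinite diameter of $E$. A set $E\subset\mathbb{C}^d$ is pluripolar if there is a plurisubharmonic function $u\not\equiv-\infty$ on $\mathbb{C}^d$ with $u=-\infty$ on $E$. Let $K\subset\mathbb{C}^d$ be compact and nonpluripolar, and let $\{K_n\}$ be any sequence of compact sets which decrease to $K$, i.e. $K_{n+1}\subset K_n$ for all $n$ and $K=\bigcap_n K_n$. Then the limit $\delta(K)$ exists and $$\lim_{n\to\infty}\delta_n(K_n)=\delta(K).$$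 -/

import Mathlib

noncomputable section

namespace PluriPot

/-! ### Plurisubharmonic functions and pluripolar sets -/

/-- The mean value `∫₀¹ u(a + e^{2πit} b) dt ∈ [-∞, ∞]` of an extended-real-valued function `u` over
the circle with centre `a` in the complex direction `b`, as the integral of the positive part minus
that of the negative part. (For `u` upper semicontinuous and `< ∞` the first of the two is finite.) -/
def circleMean {d : ℕ} (u : (Fin d → ℂ) → EReal) (a b : Fin d → ℂ) : EReal :=
  ((∫⁻ t in Set.Ioc (0 : ℝ) 1,
      (u (a + Complex.exp (2 * Real.pi * t * Complex.I) • b)).toENNReal : ENNReal) : EReal) -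
  ((∫⁻ t in Set.Ioc (0 : ℝ) 1,
      (-u (a + Complex.exp (2 * Real.pi * t * Complex.I) • b)).toENNReal : ENNReal) : EReal)

/-- `u : ℂᵈ → [-∞, ∞)` is plurisubharmonic on `ℂᵈ`: it is upper semicontinuous and satisfies the
sub-mean value inequality on every circle of every complex line. (The function identically equal to
`-∞` is admitted here, and excluded explicitly in `IsPluripolar`.) -/
structure IsPSH {d : ℕ} (u : (Fin d → ℂ) → EReal) : Prop where
  lt_top : ∀ z, u z < ⊤
  upperSemicontinuous : UpperSemicontinuous u
  le_circleMean : ∀ a b : Fin d → ℂ, u a ≤ circleMean u a b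

/-- `E ⊆ ℂᵈ` is pluripolar: it is contained in the `-∞`-set of a plurisubharmonic function on `ℂᵈ`
that is not identically `-∞`. -/
def IsPluripolar {d : ℕ} (E : Set (Fin d → ℂ)) : Prop :=
  ∃ u : (Fin d → ℂ) → EReal, IsPSH u ∧ (∃ z, u z ≠ ⊥) ∧ ∀ z ∈ E, u z = ⊥

/-! ### Vandermonde determinants and the transfinite diameter -/

/-- The multi-indices `α ∈ ℕᵈ` with `|α| ≤ n`. The type `DegLex` carries the graded lexicographic
order: first by degree `|α|`, then lexicographically. -/
def multiIndices (d n : ℕ) : Finset (DegLex (Fin d →₀ ℕ)) :=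
  (Finsupp.finite_of_degree_le (σ := Fin d) n).toFinset.map toDegLex.toEmbedding

/-- `m_n`, the number of monomials of degree at most `n` in `d` variables. -/
def numMonomials (d n : ℕ) : ℕ := (multiIndices d n).card

/-- `α(1), …, α(m_n)`: the multi-indices of degree at most `n`, listed increasingly in the graded
lexicographic order. -/
def exponent (d n : ℕ) (i : Fin (numMonomials d n)) : Fin d →₀ ℕ :=
  ofDegLex ((multiIndices d n).orderEmbOfFin rfl i)

/-- The monomial `e_i(z) = z^{α(i)}`. -/
def monomialFn (d n : ℕ) (i : Fin (numMonomials d n)) (z : Fin d → ℂ) : ℂ :=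
  ∏ k, z k ^ exponent d n i k

/-- The generalized Vandermonde determinant `VDM(ζ_1, …, ζ_{m_n}) = det [e_i(ζ_j)]`. -/
def vdm (d n : ℕ) (ζ : Fin (numMonomials d n) → Fin d → ℂ) : ℂ :=
  (Matrix.of fun i j => monomialFn d n i (ζ j)).det

/-- `l_n = ∑_{j ≤ m_n} deg e_j`. -/
def sumDegrees (d n : ℕ) : ℕ := ∑ j, (exponent d n j).degree

/-- `V_{m_n}(K) = max {|VDM(ζ_1, …, ζ_{m_n})| : ζ_1, …, ζ_{m_n} ∈ K}`
(for `K` compact and nonempty the supremum is attained). -/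
def maxVdm {d : ℕ} (n : ℕ) (K : Set (Fin d → ℂ)) : ℝ :=
  sSup {r : ℝ | ∃ ζ : Fin (numMonomials d n) → Fin d → ℂ, (∀ j, ζ j ∈ K) ∧ r = ‖vdm d n ζ‖}

/-- The `n`-th order diameter `δ_n(K) = V_{m_n}(K)^{1/l_n}`. -/
def nthDiam {d : ℕ} (n : ℕ) (K : Set (Fin d → ℂ)) : ℝ :=
  maxVdm n K ^ (1 / (sumDegrees d n : ℝ))

/-- The transfinite diameter `δ(K) = lim_{n → ∞} δ_n(K)`. -/
def transfiniteDiameter {d : ℕ} (K : Set (Fin d → ℂ)) : ℝ :=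
  Filter.limUnder Filter.atTop fun n => nthDiam n K

end PluriPot

end

open Finset Filter Topology

namespace PluriPot

/-! The transfinite diameter of every compact set exists and is continuous along decreasing sequences.
The geometric means of the Chebyshev constants
over each degree are submultiplicative in the degree, so `δ(K)` is an infimum of quantities that
depend on finitely many Chebyshev constants each. The hypothesis that `K` is nonpluripolar is
therefore not needed for the main theorem. -/

/-! ### Hypergeometric weights on pairs of multi-indices -/

/-! Write `T α` for the Chebyshev constant of `K` and `G k` for its geometric mean over `|α| = k`.
Row operations and expansion along the last point squeeze the maximal Vandermonde determinant
between `∏ T α` and `m_n! * ∏ T α`, with `|α| ≤ n` (`prod_chebyshev_le_maxVdm`, `maxVdm_le`). The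
factorial disappears under the `l_n`-th root because `m_n ≤ (n + 1) ^ d` and `m_n / l_n ≤ 2 / n`. So
the numbers `G k` decide everything.

`T` is submultiplicative, and so is `G` (`degreeMean_add_le`): the weights `splitWeight β γ` on
pairs of degrees `j` and `k` make each of `β`, `γ` and `β + γ` uniformly distributed in its degree.
As in Fekete's lemma, `c = inf (G k) ^ (1 / k)` bounds every `δ_n(K)` with `n ≥ 1` from below, while
a single `k` with `G k ≤ a ^ k` bounds their limsup by `a`.

For fixed `k`, `G k` involves finitely many Chebyshev constants, each continuous along decreasing
compact sets (`tendsto_chebyshev`). Given `a > c`, some fixed `K_m` therefore has `G k ≤ a ^ k`, and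
`δ_n(K) ≤ δ_n(K_n) ≤ δ_n(K_m)` for `n ≥ m` closes the squeeze. -/

/-- The number of ways to split `β + γ` coloured objects, grouped by colour, into `β` and `γ`. -/
def splitWeight {d : ℕ} (β γ : Fin d →₀ ℕ) : ℕ := ∏ i, (β i + γ i).choose (β i)

/-- The multi-indices of degree exactly `n`. -/
def degreeEq (d n : ℕ) : Finset (Fin d →₀ ℕ) := (univ : Finset (Fin d)).finsuppAntidiag n

lemma mem_degreeEq {d n : ℕ} {α : Fin d →₀ ℕ} : α ∈ degreeEq d n ↔ α.degree = n := by
  simp [degreeEq, Finsupp.degree_eq_sum]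

lemma splitWeight_comm {d : ℕ} (β γ : Fin d →₀ ℕ) : splitWeight β γ = splitWeight γ β :=
  prod_congr rfl fun i _ => by rw [Nat.choose_symm_add, add_comm]

lemma add_mem_degreeEq {d j k : ℕ} {β γ : Fin d →₀ ℕ} (hβ : β ∈ degreeEq d j)
    (hγ : γ ∈ degreeEq d k) : β + γ ∈ degreeEq d (j + k) := by
  rw [mem_degreeEq] at *
  rw [map_add, hβ, hγ]

/-- Compare coefficients of `X ^ j` in `∏ (1 + X) ^ α i = (1 + X) ^ |α|`. -/
lemma sum_prod_choose {d : ℕ} (α : Fin d →₀ ℕ) (j : ℕ) :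
    ∑ β ∈ degreeEq d j, ∏ i, (α i).choose (β i) = α.degree.choose j := by
  have h := PowerSeries.coeff_prod (R := ℕ)
    (fun i : Fin d => ((1 + Polynomial.X : Polynomial ℕ) ^ α i : Polynomial ℕ)) j univ
  simp only [Polynomial.coeff_coe, Polynomial.coeff_one_add_X_pow, Nat.cast_id] at h
  rw [degreeEq, ← h, Finsupp.degree_eq_sum]
  have h2 : (∏ i : Fin d, (((1 + Polynomial.X : Polynomial ℕ) ^ α i : Polynomial ℕ) :
      PowerSeries ℕ)) = ((1 + Polynomial.X : Polynomial ℕ) ^ (∑ i, α i) : Polynomial ℕ) := by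
    rw [← prod_pow_eq_pow_sum]
    exact (map_prod (Polynomial.coeToPowerSeries.ringHom (R := ℕ)) _ _).symm
  rw [h2, Polynomial.coeff_coe, Polynomial.coeff_one_add_X_pow, Nat.cast_id]

/-- The fibre weight does not depend on `α`: the sum `β + γ` is uniformly distributed. -/
lemma sum_splitWeight_fiber {d j k : ℕ} {α : Fin d →₀ ℕ} (hα : α ∈ degreeEq d (j + k)) :
    ∑ x ∈ degreeEq d j ×ˢ degreeEq d k with x.1 + x.2 = α, splitWeight x.1 x.2 =
      (j + k).choose j := by
  rw [mem_degreeEq] at hα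
  rw [← hα, ← sum_prod_choose α j,
    ← sum_filter_of_ne (s := degreeEq d j) (p := fun β => β ≤ α)]
  · refine sum_nbij' (fun x => x.1) (fun β => (β, α - β)) ?_ ?_ ?_ ?_ ?_
    · rintro ⟨β, γ⟩ h
      simp only [mem_filter, mem_product] at h ⊢
      exact ⟨h.1.1, h.2 ▸ le_self_add⟩
    · intro β h
      simp only [mem_filter, mem_product] at h ⊢
      refine ⟨⟨h.1, ?_⟩, add_tsub_cancel_of_le h.2⟩
      have h1 := mem_degreeEq.1 h.1
      have h2 := congrArg Finsupp.degree (add_tsub_cancel_of_le h.2)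
      rw [map_add] at h2
      rw [mem_degreeEq]
      omega
    · rintro ⟨β, γ⟩ h
      simp only [mem_filter, mem_product] at h ⊢
      rw [← h.2, add_tsub_cancel_left]
    · intro β h
      rfl
    · rintro ⟨β, γ⟩ h
      simp only [mem_filter, mem_product] at h ⊢
      simp [← h.2, splitWeight]
  · intro β _ h i
    by_contra! hlt
    exact h (prod_eq_zero (mem_univ i) (Nat.choose_eq_zero_of_lt hlt))

/-- The sum is the coefficient of `X ^ k` in `∏ (1 - X) ^ (-(β i + 1)) = (1 - X) ^ (-(j + d))`,
which sees `β` only through its degree. Hence the marginals `β` and, by symmetry, `γ` are uniform.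
-/
lemma exists_sum_splitWeight_eq (d j k : ℕ) :
    ∃ D : ℕ, ∀ β ∈ degreeEq d j, ∑ γ ∈ degreeEq d k, splitWeight β γ = D := by
  have key : ∀ β ∈ degreeEq d j, ((∑ γ ∈ degreeEq d k, splitWeight β γ : ℕ) : ℤ) =
      PowerSeries.coeff k (PowerSeries.invOneSubPow ℤ (j + d)).val := by
    intro β hβ
    rw [mem_degreeEq, Finsupp.degree_eq_sum] at hβ
    have h1 : PowerSeries.invOneSubPow ℤ (j + d) =
        ∏ i, PowerSeries.invOneSubPow ℤ (β i + 1) := by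
      simp_rw [PowerSeries.invOneSubPow_eq_inv_one_sub_pow]
      rw [prod_pow_eq_pow_sum, sum_add_distrib, hβ]
      simp
    rw [h1, Units.coe_prod, PowerSeries.coeff_prod]
    push_cast [splitWeight, degreeEq]
    refine sum_congr rfl fun γ _ => prod_congr rfl fun i _ => ?_
    rw [PowerSeries.invOneSubPow_val_succ_eq_mk_add_choose, PowerSeries.coeff_mk]
  by_cases h : (degreeEq d j).Nonempty
  · obtain ⟨β₀, h₀⟩ := h
    exact ⟨∑ γ ∈ degreeEq d k, splitWeight β₀ γ, fun β hβ => by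
      exact_mod_cast (key β hβ).trans (key β₀ h₀).symm⟩
  · exact ⟨0, fun β hβ => absurd ⟨β, hβ⟩ h⟩

/-! ### Geometric means of submultiplicative functions of a multi-index -/

/-- The geometric mean of `T` over the multi-indices of degree `n`. -/
noncomputable def degreeMean {d : ℕ} (T : (Fin d →₀ ℕ) → ℝ) (n : ℕ) : ℝ :=
  (∏ α ∈ degreeEq d n, T α) ^ (1 / ((degreeEq d n).card : ℝ))

lemma degreeEq_nonempty {d : ℕ} (hd : 1 ≤ d) (n : ℕ) : (degreeEq d n).Nonempty :=
  ⟨Finsupp.single ⟨0, hd⟩ n, by simp [mem_degreeEq]⟩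

lemma degreeMean_nonneg {d : ℕ} {T : (Fin d →₀ ℕ) → ℝ} (hT : ∀ α, 0 ≤ T α) (n : ℕ) :
    0 ≤ degreeMean T n :=
  Real.rpow_nonneg (prod_nonneg fun α _ => hT α) _

lemma degreeMean_pow {d : ℕ} (hd : 1 ≤ d) {T : (Fin d →₀ ℕ) → ℝ} (hT : ∀ α, 0 ≤ T α) (n : ℕ) :
    degreeMean T n ^ (degreeEq d n).card = ∏ α ∈ degreeEq d n, T α := by
  rw [degreeMean, one_div,
    Real.rpow_inv_natCast_pow (prod_nonneg fun α _ => hT α) (degreeEq_nonempty hd n).card_pos.ne']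

/-- Geometric means of a submultiplicative function are submultiplicative in the degree. -/
lemma degreeMean_add_le {d : ℕ} (hd : 1 ≤ d) {T : (Fin d →₀ ℕ) → ℝ} (hT : ∀ α, 0 ≤ T α)
    (hmul : ∀ α β, T (α + β) ≤ T α * T β) (j k : ℕ) :
    degreeMean T (j + k) ≤ degreeMean T j * degreeMean T k := by
  obtain ⟨D, hD⟩ := exists_sum_splitWeight_eq d j k
  obtain ⟨D', hD'⟩ := exists_sum_splitWeight_eq d k j
  set Q := degreeEq d j ×ˢ degreeEq d k
  have hmaps : ∀ x ∈ Q, x.1 + x.2 ∈ degreeEq d (j + k) := fun x hx =>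
    add_mem_degreeEq (mem_product.1 hx).1 (mem_product.1 hx).2
  -- The total weight, computed through each of the three uniform marginals. It becomes the common
  -- exponent of the three geometric means in `e1`, `e2`, `e3`.
  have c1 : ∑ x ∈ Q, splitWeight x.1 x.2 = (degreeEq d (j + k)).card * (j + k).choose j := by
    rw [← sum_fiberwise_of_maps_to hmaps, sum_congr rfl fun α hα => sum_splitWeight_fiber hα,
      sum_const, smul_eq_mul]
  have c2 : ∑ x ∈ Q, splitWeight x.1 x.2 = (degreeEq d j).card * D := by
    rw [sum_product, sum_congr rfl hD, sum_const, smul_eq_mul]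
  have c3 : ∑ x ∈ Q, splitWeight x.1 x.2 = (degreeEq d k).card * D' := by
    simp_rw [Q, sum_product_right, fun x y : Fin d →₀ ℕ => splitWeight_comm x y]
    rw [sum_congr rfl hD', sum_const, smul_eq_mul]
  have e1 : ∏ x ∈ Q, T (x.1 + x.2) ^ splitWeight x.1 x.2 =
      degreeMean T (j + k) ^ ∑ x ∈ Q, splitWeight x.1 x.2 := by
    rw [c1, pow_mul, degreeMean_pow hd hT, ← prod_pow, ← prod_fiberwise_of_maps_to hmaps]
    refine prod_congr rfl fun α hα => ?_
    rw [← sum_splitWeight_fiber hα, ← prod_pow_eq_pow_sum]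
    exact prod_congr rfl fun x hx => by rw [(mem_filter.1 hx).2]
  have e2 : ∏ x ∈ Q, T x.1 ^ splitWeight x.1 x.2 =
      degreeMean T j ^ ∑ x ∈ Q, splitWeight x.1 x.2 := by
    rw [c2, pow_mul, degreeMean_pow hd hT, ← prod_pow, prod_product]
    refine prod_congr rfl fun α hα => ?_
    rw [← hD α hα, ← prod_pow_eq_pow_sum]
  have e3 : ∏ x ∈ Q, T x.2 ^ splitWeight x.1 x.2 =
      degreeMean T k ^ ∑ x ∈ Q, splitWeight x.1 x.2 := by
    rw [c3, pow_mul, degreeMean_pow hd hT, ← prod_pow, prod_product_right]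
    refine prod_congr rfl fun α hα => ?_
    rw [← hD' α hα, ← prod_pow_eq_pow_sum]
    exact prod_congr rfl fun x _ => by rw [splitWeight_comm α x]
  have hpos : ∑ x ∈ Q, splitWeight x.1 x.2 ≠ 0 := by
    rw [c1]
    exact (Nat.mul_pos (degreeEq_nonempty hd _).card_pos
      (Nat.choose_pos (Nat.le_add_right j k))).ne'
  refine le_of_pow_le_pow_left₀ hpos
    (mul_nonneg (degreeMean_nonneg hT j) (degreeMean_nonneg hT k)) ?_
  rw [mul_pow, ← e1, ← e2, ← e3, ← prod_mul_distrib]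
  refine prod_le_prod (fun x _ => pow_nonneg (hT _) _) fun x _ => ?_
  rw [← mul_pow]
  exact pow_le_pow_left₀ (hT _) (hmul _ _) _

lemma degreeMean_le_pow {d : ℕ} (hd : 1 ≤ d) {T : (Fin d →₀ ℕ) → ℝ} (hT : ∀ α, 0 ≤ T α)
    {R : ℝ} (hR : 0 ≤ R) (hTR : ∀ α, T α ≤ R ^ α.degree) (n : ℕ) : degreeMean T n ≤ R ^ n := by
  refine le_of_pow_le_pow_left₀ (degreeEq_nonempty hd n).card_pos.ne' (pow_nonneg hR n) ?_
  rw [degreeMean_pow hd hT]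
  exact (prod_le_prod (fun α _ => hT α)
    fun α hα => (hTR α).trans_eq (by rw [mem_degreeEq.1 hα])).trans_eq (prod_const _)

/-- If one geometric mean satisfies `degreeMean T k ≤ a ^ k`, all of them do up to a constant. -/
lemma exists_degreeMean_le {d : ℕ} (hd : 1 ≤ d) {T : (Fin d →₀ ℕ) → ℝ} (hT : ∀ α, 0 ≤ T α)
    (hmul : ∀ α β, T (α + β) ≤ T α * T β) {R : ℝ} (hTR : ∀ α, T α ≤ R ^ α.degree)
    (hR : 0 ≤ R) {a : ℝ} (ha : 0 < a) {k : ℕ} (hk : 0 < k) (hak : degreeMean T k ≤ a ^ k) :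
    ∃ M : ℝ, 1 ≤ M ∧ ∀ n, degreeMean T n ≤ M * a ^ n := by
  -- With `R ≤ b * a`, the factor `b ^ k` absorbs all degrees below `k`; higher degrees peel off `k`
  -- at a time at cost `a ^ k`.
  set b := max 1 (R / a) with hb
  have hb1 : 1 ≤ b := le_max_left _ _
  have hRb : R ≤ b * a := (div_le_iff₀ ha).1 (le_max_right _ _)
  refine ⟨b ^ k, one_le_pow₀ hb1, fun n => ?_⟩
  induction n using Nat.strong_induction_on with
  | _ n ih =>
    rcases lt_or_ge n k with h | h
    · calc degreeMean T n ≤ R ^ n := degreeMean_le_pow hd hT hR hTR n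
        _ ≤ (b * a) ^ n := pow_le_pow_left₀ hR hRb n
        _ = b ^ n * a ^ n := mul_pow _ _ _
        _ ≤ b ^ k * a ^ n := by gcongr
    · obtain ⟨m, rfl⟩ := Nat.exists_eq_add_of_le' h
      calc degreeMean T (m + k) ≤ degreeMean T m * degreeMean T k :=
            degreeMean_add_le hd hT hmul m k
        _ ≤ (b ^ k * a ^ m) * a ^ k := mul_le_mul (ih m (by omega)) hak
            (degreeMean_nonneg hT k) (by positivity)
        _ = b ^ k * a ^ (m + k) := by ring

/-! ### Determinants and Chebyshev constants of a finite sequence of functions -/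

/-- The bounds on `K` for functions `f i + ∑_{j < i} c_j f j`. -/
def monicBounds {X : Type*} {M : ℕ} (f : Fin M → X → ℂ) (K : Set X) (i : Fin M) : Set ℝ :=
  {C | 0 ≤ C ∧ ∃ p : X → ℂ, p - f i ∈ Submodule.span ℂ (f '' Set.Iio i) ∧ ∀ z ∈ K, ‖p z‖ ≤ C}

lemma norm_det_le_factorial_mul_prod {M : ℕ} (A : Matrix (Fin M) (Fin M) ℂ) (c : Fin M → ℝ)
    (hA : ∀ i j, ‖A i j‖ ≤ c i) : ‖A.det‖ ≤ (M.factorial : ℝ) * ∏ i, c i := by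
  rw [← Matrix.det_transpose, Matrix.det_apply]
  refine (norm_sum_le _ _).trans ?_
  have : ∀ σ ∈ (univ : Finset (Equiv.Perm (Fin M))),
      ‖Equiv.Perm.sign σ • ∏ i, A.transpose (σ i) i‖ ≤ ∏ i, c i := by
    intro σ _
    have hσ : ∀ z : ℂ, ‖Equiv.Perm.sign σ • z‖ = ‖z‖ := fun z => by
      rcases Int.units_eq_one_or (Equiv.Perm.sign σ) with h | h <;> simp [h]
    rw [hσ, norm_prod]
    exact prod_le_prod (fun _ _ => norm_nonneg _) fun i _ => hA i (σ i)
  refine (sum_le_card_nsmul _ _ _ this).trans_eq ?_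
  rw [nsmul_eq_mul, card_univ, Fintype.card_perm, Fintype.card_fin]

/-- Replacing each `f i` by a competitor `p i` is a unipotent lower triangular row operation, which
preserves the determinant; then the Leibniz formula has `M!` terms. -/
lemma norm_det_le_of_mem_monicBounds {X : Type*} {M : ℕ} {f : Fin M → X → ℂ} {K : Set X}
    {c : Fin M → ℝ} (hc : ∀ i, c i ∈ monicBounds f K i) {ζ : Fin M → X} (hζ : ∀ j, ζ j ∈ K) :
    ‖(Matrix.of fun i j => f i (ζ j)).det‖ ≤ (M.factorial : ℝ) * ∏ i, c i := by
  choose _ p hp hpK using hc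
  simp_rw [Finsupp.mem_span_image_iff_linearCombination, Finsupp.mem_supported'] at hp
  choose l hl hlp using hp
  set N : Matrix (Fin M) (Fin M) ℂ := 1 + Matrix.of fun i j => l i j
  have hdet : N.det = 1 := by
    rw [Matrix.det_of_isLowerTriangular]
    · refine prod_eq_one fun i _ => ?_
      simp [N, hl i i (by simp)]
    · intro i j hij
      have hij' : i < j := hij
      simp [N, Matrix.one_apply_ne hij'.ne, hl i j (by simpa using hij'.le)]
  have hmul : N * (Matrix.of fun i j => f i (ζ j)) = Matrix.of fun i j => p i (ζ j) := by
    ext i j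
    have := congrFun (hlp i) (ζ j)
    rw [Finsupp.linearCombination_apply, Finsupp.sum_fintype _ _ (by simp)] at this
    simp only [Finset.sum_apply, Pi.smul_apply, smul_eq_mul, Pi.sub_apply] at this
    rw [add_mul, one_mul, Matrix.add_apply, Matrix.mul_apply]
    simp only [Matrix.of_apply, this]
    ring
  rw [← one_mul (Matrix.det _), ← hdet, ← Matrix.det_mul, hmul]
  exact norm_det_le_factorial_mul_prod _ _ fun i j => hpK i _ (hζ j)

/-- As a function of its last point, the determinant is `D * f (last)` plus a combination of earlier
functions, where `D` is the minor on the other points. Dividing by `D` gives a competitor bounded by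
`B / ‖D‖`, so `t (last) * ‖D‖ ≤ B`, and induction applies to `D`. -/
lemma prod_le_of_norm_det_le {X : Type*} {K : Set X} {M : ℕ} (f : Fin M → X → ℂ)
    {t : Fin M → ℝ} (ht : ∀ i, 0 ≤ t i) (htC : ∀ i, ∀ C ∈ monicBounds f K i, t i ≤ C) {B : ℝ}
    (hB0 : 0 ≤ B)
    (hB : ∀ ζ : Fin M → X, (∀ j, ζ j ∈ K) → ‖(Matrix.of fun i j => f i (ζ j)).det‖ ≤ B) :
    ∏ i, t i ≤ B := by
  induction M generalizing B with
  | zero => simpa using hB Fin.elim0 (fun j => j.elim0)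
  | succ M ih =>
    rw [Fin.prod_univ_castSucc]
    rcases (ht (Fin.last M)).eq_or_lt with h0 | h0
    · rwa [← h0, mul_zero]
    rw [← le_div_iff₀ h0]
    refine ih (fun i => f i.castSucc) (fun i => ht _) (fun i C hC => htC _ C ?_)
      (div_nonneg hB0 h0.le) fun ζ hζ => ?_
    · obtain ⟨hC0, p, hp, hpK⟩ := hC
      refine ⟨hC0, p, Submodule.span_mono ?_ hp, hpK⟩
      rintro _ ⟨j, hj, rfl⟩
      exact ⟨j.castSucc, by simpa using hj, rfl⟩
    · set D := (Matrix.of fun i j => f (Fin.castSucc i) (ζ j)).det with hD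
      rcases (norm_nonneg D).eq_or_lt with hD0 | hD0
      · rw [← hD0]; exact div_nonneg hB0 h0.le
      rw [le_div_iff₀ h0, mul_comm, ← le_div_iff₀ hD0]
      have hDne : D ≠ 0 := norm_pos_iff.1 hD0
      let F : X → ℂ := fun z => (Matrix.of fun i j => f i (Fin.snoc (α := fun _ => X) ζ z j)).det
      -- The cofactors of the last column; the last of them is `D`.
      let m : Fin (M + 1) → ℂ := fun i =>
        (-1) ^ ((i : ℕ) + M) * (Matrix.of fun i' j => f (i.succAbove i') (ζ j)).det
      have hF : ∀ z, F z = ∑ i, m i * f i z := by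
        intro z
        simp only [F]
        rw [Matrix.det_succ_column _ (Fin.last M)]
        refine sum_congr rfl fun i _ => ?_
        have : (Matrix.of fun i j => f i (Fin.snoc (α := fun _ => X) ζ z j)).submatrix i.succAbove
            (Fin.last M).succAbove = Matrix.of fun i' j => f (i.succAbove i') (ζ j) := by
          ext a b
          simp
        rw [this]
        simp only [m, Matrix.of_apply, Fin.snoc_last, Fin.val_last]
        ring
      have hm : m (Fin.last M) = D := by
        simp only [m, Fin.succAbove_last, Fin.val_last, hD]
        rw [← two_mul, pow_mul]
        simp
      refine htC (Fin.last M) _ ⟨div_nonneg hB0 hD0.le, D⁻¹ • F, ?_, fun z hz => ?_⟩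
      · have : D⁻¹ • F - f (Fin.last M) =
            ∑ i : Fin M, (D⁻¹ * m i.castSucc) • f i.castSucc := by
          ext z
          simp only [Pi.sub_apply, Pi.smul_apply, Finset.sum_apply, smul_eq_mul, hF,
            Fin.sum_univ_castSucc, hm, mul_add, Finset.mul_sum]
          rw [inv_mul_cancel_left₀ hDne, add_sub_cancel_right]
          simp_rw [mul_assoc]
        rw [this]
        exact Submodule.sum_mem _ fun i _ => Submodule.smul_mem _ _
          (Submodule.subset_span ⟨_, Fin.castSucc_lt_last i, rfl⟩)
      · rw [Pi.smul_apply, norm_smul, norm_inv, inv_mul_eq_div]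
        gcongr
        refine hB _ fun j => ?_
        refine Fin.lastCases ?_ (fun j => ?_) j
        · simpa using hz
        · simpa using hζ j

/-! ### Chebyshev constants of compact sets -/

/-- The monomial function `z ^ α`. -/
def monomialAt {d : ℕ} (α : DegLex (Fin d →₀ ℕ)) (z : Fin d → ℂ) : ℂ := ∏ k, z k ^ ofDegLex α k

/-- The bounds on `K` for polynomials with leading term `z ^ α`. -/
def chebyshevBounds {d : ℕ} (K : Set (Fin d → ℂ)) (α : Fin d →₀ ℕ) : Set ℝ :=
  {C | 0 ≤ C ∧ ∃ p : (Fin d → ℂ) → ℂ,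
    p - monomialAt (toDegLex α) ∈ Submodule.span ℂ (monomialAt '' Set.Iio (toDegLex α)) ∧
      ∀ z ∈ K, ‖p z‖ ≤ C}

/-- The Chebyshev constant of `K` for the multi-index `α`: the least sup norm on `K` of a
polynomial with leading term `z ^ α`. -/
noncomputable def chebyshev {d : ℕ} (K : Set (Fin d → ℂ)) (α : Fin d →₀ ℕ) : ℝ :=
  sInf (chebyshevBounds K α)

variable {d : ℕ} {K : Set (Fin d → ℂ)} {α β : Fin d →₀ ℕ}

lemma monomialAt_add (a b : DegLex (Fin d →₀ ℕ)) :
    monomialAt (a + b) = monomialAt a * monomialAt b := by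
  ext z
  simp [monomialAt, ofDegLex_add, pow_add, prod_mul_distrib]

lemma continuous_monomialAt (a : DegLex (Fin d →₀ ℕ)) : Continuous (monomialAt a) := by
  unfold monomialAt
  fun_prop

lemma norm_monomialAt_le {R : ℝ} {z : Fin d → ℂ} (hz : ‖z‖ ≤ R) :
    ‖monomialAt (toDegLex α) z‖ ≤ R ^ α.degree := by
  rw [monomialAt, norm_prod, Finsupp.degree_eq_sum, ← prod_pow_eq_pow_sum]
  refine prod_le_prod (fun _ _ => norm_nonneg _) fun k _ => ?_
  rw [norm_pow]
  exact pow_le_pow_left₀ (norm_nonneg _) ((norm_le_pi_norm z k).trans hz) _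

lemma pow_mem_chebyshevBounds {R : ℝ} (hR : 0 ≤ R) (hKR : ∀ z ∈ K, ‖z‖ ≤ R) (α : Fin d →₀ ℕ) :
    R ^ α.degree ∈ chebyshevBounds K α :=
  ⟨pow_nonneg hR _, monomialAt (toDegLex α), by simp, fun z hz => norm_monomialAt_le (hKR z hz)⟩

lemma bddBelow_chebyshevBounds : BddBelow (chebyshevBounds K α) := ⟨0, fun _ hC => hC.1⟩

lemma chebyshev_nonneg : 0 ≤ chebyshev K α := Real.sInf_nonneg fun _ hC => hC.1

lemma chebyshev_le_of_mem {C : ℝ} (hC : C ∈ chebyshevBounds K α) : chebyshev K α ≤ C :=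
  csInf_le bddBelow_chebyshevBounds hC

lemma exists_norm_le_of_isCompact (hK : IsCompact K) : ∃ R : ℝ, 0 ≤ R ∧ ∀ z ∈ K, ‖z‖ ≤ R := by
  obtain ⟨R, hR⟩ := hK.exists_bound_of_continuousOn continuousOn_id
  exact ⟨max R 0, le_max_right _ _, fun z hz => (hR z hz).trans (le_max_left _ _)⟩

lemma chebyshevBounds_nonempty (hK : IsCompact K) (α : Fin d →₀ ℕ) :
    (chebyshevBounds K α).Nonempty := by
  obtain ⟨R, hR, hKR⟩ := exists_norm_le_of_isCompact hK
  exact ⟨_, pow_mem_chebyshevBounds hR hKR α⟩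

lemma mem_chebyshevBounds_of_lt (hK : IsCompact K) {C : ℝ} (hC : chebyshev K α < C) :
    C ∈ chebyshevBounds K α := by
  obtain ⟨C', ⟨h0, p, hp, hpK⟩, hlt⟩ :=
    exists_lt_of_csInf_lt (chebyshevBounds_nonempty hK α) hC
  exact ⟨h0.trans hlt.le, p, hp, fun z hz => (hpK z hz).trans hlt.le⟩

/-- Graded lexicographic order is compatible with addition, so leading terms multiply. -/
lemma mul_mem_chebyshevBounds {C C' : ℝ} (hC : C ∈ chebyshevBounds K α)
    (hC' : C' ∈ chebyshevBounds K β) : C * C' ∈ chebyshevBounds K (α + β) := by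
  obtain ⟨h0, p, hp, hpK⟩ := hC
  obtain ⟨h0', q, hq, hqK⟩ := hC'
  refine ⟨mul_nonneg h0 h0', p * q, ?_, fun z hz => ?_⟩
  · rw [toDegLex_add, monomialAt_add]
    set a := toDegLex α
    set b := toDegLex β
    have key : ∀ {f g : (Fin d → ℂ) → ℂ} {s t : Set (DegLex (Fin d →₀ ℕ))},
        f ∈ Submodule.span ℂ (monomialAt '' s) → g ∈ Submodule.span ℂ (monomialAt '' t) →
        (∀ x ∈ s, ∀ y ∈ t, x + y < a + b) →
        f * g ∈ Submodule.span ℂ (monomialAt '' Set.Iio (a + b)) := by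
      intro f g s t hf hg h
      have hfg := Submodule.mul_mem_mul hf hg
      rw [Submodule.span_mul_span] at hfg
      refine Submodule.span_mono ?_ hfg
      rintro _ ⟨_, ⟨x, hx, rfl⟩, _, ⟨y, hy, rfl⟩, rfl⟩
      exact ⟨x + y, h x hx y hy, monomialAt_add x y⟩
    have hb : monomialAt b ∈ Submodule.span ℂ (monomialAt '' {b}) :=
      Submodule.subset_span ⟨b, rfl, rfl⟩
    have ha : monomialAt a ∈ Submodule.span ℂ (monomialAt '' {a}) :=
      Submodule.subset_span ⟨a, rfl, rfl⟩
    have e : p * q - monomialAt a * monomialAt b =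
        (p - monomialAt a) * (q - monomialAt b) + (p - monomialAt a) * monomialAt b +
          monomialAt a * (q - monomialAt b) := by ring
    rw [e]
    refine Submodule.add_mem _ (Submodule.add_mem _ (key hp hq ?_) (key hp hb ?_)) (key ha hq ?_)
    · exact fun x hx y hy => add_lt_add hx hy
    · rintro x hx _ rfl
      exact add_lt_add_left hx _
    · rintro _ rfl y hy
      exact add_lt_add_right hy _
  · rw [Pi.mul_apply, norm_mul]
    exact mul_le_mul (hpK z hz) (hqK z hz) (norm_nonneg _) h0

/-- Serves to pass to the infimum `chebyshev` from bounds `chebyshev + ε`, without showing that the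
infimum is attained. -/
lemma tendsto_add_nhdsGT_zero (x : ℝ) : Tendsto (fun ε : ℝ => x + ε) (𝓝[>] 0) (𝓝 x) := by
  have : Tendsto (fun ε : ℝ => x + ε) (𝓝 0) (𝓝 (x + 0)) :=
    tendsto_const_nhds.add tendsto_id
  rw [add_zero] at this
  exact this.mono_left nhdsWithin_le_nhds

lemma chebyshev_add_le (hK : IsCompact K) (α β : Fin d →₀ ℕ) :
    chebyshev K (α + β) ≤ chebyshev K α * chebyshev K β := by
  refine ge_of_tendsto ((tendsto_add_nhdsGT_zero _).mul (tendsto_add_nhdsGT_zero _)) ?_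
  filter_upwards [self_mem_nhdsWithin] with ε hε
  exact chebyshev_le_of_mem (mul_mem_chebyshevBounds
    (mem_chebyshevBounds_of_lt hK (lt_add_of_pos_right _ hε))
    (mem_chebyshevBounds_of_lt hK (lt_add_of_pos_right _ hε)))

lemma chebyshev_mono {K' : Set (Fin d → ℂ)} (h : K ⊆ K') (hK' : IsCompact K')
    (α : Fin d →₀ ℕ) : chebyshev K α ≤ chebyshev K' α :=
  csInf_le_csInf bddBelow_chebyshevBounds (chebyshevBounds_nonempty hK' α)
    fun _ ⟨h0, p, hp, hpK⟩ => ⟨h0, p, hp, fun z hz => hpK z (h hz)⟩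

/-- A nearly optimal polynomial for the intersection stays small on an open neighbourhood, which by
compactness contains some `Kseq m`. The other inequality is monotonicity. -/
lemma tendsto_chebyshev {Kseq : ℕ → Set (Fin d → ℂ)} (hcompact : ∀ n, IsCompact (Kseq n))
    (hanti : Antitone Kseq) (α : Fin d →₀ ℕ) :
    Tendsto (fun m => chebyshev (Kseq m) α) atTop (𝓝 (chebyshev (⋂ n, Kseq n) α)) := by
  have hK : IsCompact (⋂ n, Kseq n) :=
    (hcompact 0).of_isClosed_subset (isClosed_iInter fun n => (hcompact n).isClosed)
      (Set.iInter_subset _ 0)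
  refine tendsto_order.2 ⟨fun a ha => Eventually.of_forall fun m =>
    ha.trans_le (chebyshev_mono (Set.iInter_subset _ m) (hcompact m) α), fun a ha => ?_⟩
  obtain ⟨b, hb, hba⟩ := exists_between ha
  obtain ⟨c, hc, hcb⟩ := exists_between hb
  obtain ⟨h0, p, hp, hpK⟩ := mem_chebyshevBounds_of_lt hK hc
  have hpcont : Continuous p := by
    have hspan : ∀ q ∈ Submodule.span ℂ (monomialAt '' Set.Iio (toDegLex α)), Continuous q := by
      intro q hq
      induction hq using Submodule.span_induction with
      | mem q hq => obtain ⟨b, _, rfl⟩ := hq; exact continuous_monomialAt b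
      | zero => exact continuous_const
      | add q r _ _ hq hr => exact hq.add hr
      | smul c q _ hq => exact hq.const_smul c
    simpa using (hspan _ hp).add (continuous_monomialAt (toDegLex α))
  have hopen : IsOpen {z | ‖p z‖ < b} := isOpen_lt hpcont.norm continuous_const
  obtain ⟨m, hm⟩ := exists_subset_nhds_of_isCompact (hanti.directed_ge) hcompact
    (fun z hz => hopen.mem_nhds ((hpK z hz).trans_lt hcb))
  filter_upwards [eventually_ge_atTop m] with n hn
  exact (chebyshev_le_of_mem ⟨h0.trans hcb.le, p, hp,
    fun z hz => (hm (hanti hn hz)).le⟩).trans_lt hba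

/-! ### Comparison with Vandermonde determinants -/

lemma mem_multiIndices {n : ℕ} {a : DegLex (Fin d →₀ ℕ)} :
    a ∈ multiIndices d n ↔ (ofDegLex a).degree ≤ n := by
  simp only [multiIndices, Finset.mem_map, Set.Finite.mem_toFinset, Set.mem_ofPred_eq]
  exact ⟨by rintro ⟨b, hb, rfl⟩; exact hb, fun h => ⟨ofDegLex a, h, rfl⟩⟩

/-- Graded order is essential: everything below an exponent of degree at most `n` again has degree
at most `n`. So the competitors do not depend on `n`. -/
lemma image_monomialFn_Iio (n : ℕ) (i : Fin (numMonomials d n)) :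
    monomialFn d n '' Set.Iio i = monomialAt '' Set.Iio (toDegLex (exponent d n i)) := by
  ext f
  constructor
  · rintro ⟨j, hj, rfl⟩
    exact ⟨toDegLex (exponent d n j), ((multiIndices d n).orderEmbOfFin rfl).strictMono hj, rfl⟩
  · rintro ⟨b, hb, rfl⟩
    have hb' : b ∈ multiIndices d n := by
      rw [mem_multiIndices]
      refine (Finsupp.DegLex.monotone_degree (le_of_lt hb)).trans ?_
      exact mem_multiIndices.1 ((multiIndices d n).orderEmbOfFin_mem rfl i)
    rw [← mem_coe, ← (multiIndices d n).range_orderEmbOfFin rfl] at hb'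
    obtain ⟨j, rfl⟩ := hb'
    exact ⟨j, ((multiIndices d n).orderEmbOfFin rfl).lt_iff_lt.1 hb, rfl⟩

lemma monicBounds_monomialFn (K : Set (Fin d → ℂ)) (n : ℕ) (i : Fin (numMonomials d n)) :
    monicBounds (monomialFn d n) K i = chebyshevBounds K (exponent d n i) := by
  rw [monicBounds, image_monomialFn_Iio]
  rfl

lemma norm_vdm_le (hK : IsCompact K) (n : ℕ) {ζ : Fin (numMonomials d n) → Fin d → ℂ}
    (hζ : ∀ j, ζ j ∈ K) :
    ‖vdm d n ζ‖ ≤ ((numMonomials d n).factorial : ℝ) * ∏ i, chebyshev K (exponent d n i) := by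
  refine ge_of_tendsto (tendsto_const_nhds.mul
    (tendsto_finsetProd _ fun i _ => tendsto_add_nhdsGT_zero _)) ?_
  filter_upwards [self_mem_nhdsWithin] with ε hε
  refine norm_det_le_of_mem_monicBounds (f := monomialFn d n) (fun i => ?_) hζ
  rw [monicBounds_monomialFn]
  exact mem_chebyshevBounds_of_lt hK (lt_add_of_pos_right _ hε)

lemma maxVdm_nonneg (n : ℕ) (K : Set (Fin d → ℂ)) : 0 ≤ maxVdm n K :=
  Real.sSup_nonneg (by rintro _ ⟨ζ, -, rfl⟩; exact norm_nonneg _)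

lemma norm_vdm_le_maxVdm (hK : IsCompact K) (n : ℕ) {ζ : Fin (numMonomials d n) → Fin d → ℂ}
    (hζ : ∀ j, ζ j ∈ K) : ‖vdm d n ζ‖ ≤ maxVdm n K :=
  le_csSup ⟨_, by rintro _ ⟨ζ, hζ, rfl⟩; exact norm_vdm_le hK n hζ⟩ ⟨ζ, hζ, rfl⟩

lemma maxVdm_le (hK : IsCompact K) (n : ℕ) :
    maxVdm n K ≤ ((numMonomials d n).factorial : ℝ) * ∏ i, chebyshev K (exponent d n i) :=
  Real.sSup_le (by rintro _ ⟨ζ, hζ, rfl⟩; exact norm_vdm_le hK n hζ)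
    (mul_nonneg (Nat.cast_nonneg _) (prod_nonneg fun _ _ => chebyshev_nonneg))

lemma prod_chebyshev_le_maxVdm (hK : IsCompact K) (n : ℕ) :
    ∏ i, chebyshev K (exponent d n i) ≤ maxVdm n K := by
  refine prod_le_of_norm_det_le (monomialFn d n) (fun _ => chebyshev_nonneg) (fun i C hC => ?_)
    (maxVdm_nonneg n K) fun ζ hζ => norm_vdm_le_maxVdm hK n hζ
  rw [monicBounds_monomialFn] at hC
  exact chebyshev_le_of_mem hC

lemma maxVdm_mono {K' : Set (Fin d → ℂ)} (h : K ⊆ K') (hK' : IsCompact K') (n : ℕ) :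
    maxVdm n K ≤ maxVdm n K' :=
  Real.sSup_le (by rintro _ ⟨ζ, hζ, rfl⟩; exact norm_vdm_le_maxVdm hK' n fun j => h (hζ j))
    (maxVdm_nonneg n K')

/-! ### Enumerating multi-indices by degree -/

lemma prod_exponent {M : Type*} [CommMonoid M] (d n : ℕ) (g : (Fin d →₀ ℕ) → M) :
    ∏ i, g (exponent d n i) = ∏ k ∈ range (n + 1), ∏ α ∈ degreeEq d k, g α := by
  have h1 : ∏ i, g (exponent d n i) = ∏ a ∈ multiIndices d n, g (ofDegLex a) := by
    rw [← (multiIndices d n).image_orderEmbOfFin_univ rfl,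
      prod_image ((multiIndices d n).orderEmbOfFin rfl).injective.injOn]
    rfl
  have hmaps : ∀ a ∈ multiIndices d n, (ofDegLex a).degree ∈ range (n + 1) := fun a ha =>
    mem_range.2 (Nat.lt_succ_of_le (mem_multiIndices.1 ha))
  rw [h1, ← prod_fiberwise_of_maps_to hmaps]
  refine prod_congr rfl fun k hk => ?_
  refine prod_nbij' (fun a => ofDegLex a) (fun α => toDegLex α) ?_ ?_ ?_ ?_ ?_
  · intro a ha
    exact mem_degreeEq.2 (mem_filter.1 ha).2
  · intro α hα
    rw [mem_degreeEq] at hα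
    rw [mem_filter, mem_multiIndices]
    exact ⟨hα.trans_le (Nat.lt_succ_iff.1 (mem_range.1 hk)), hα⟩
  · exact fun _ _ => rfl
  · exact fun _ _ => rfl
  · exact fun _ _ => rfl

lemma sum_exponent {M : Type*} [AddCommMonoid M] (d n : ℕ) (g : (Fin d →₀ ℕ) → M) :
    ∑ i, g (exponent d n i) = ∑ k ∈ range (n + 1), ∑ α ∈ degreeEq d k, g α :=
  prod_exponent (M := Multiplicative M) d n g

lemma numMonomials_eq_sum (d n : ℕ) :
    numMonomials d n = ∑ k ∈ range (n + 1), (degreeEq d k).card := by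
  have := sum_exponent d n (fun _ => 1)
  simpa using this

lemma sumDegrees_eq_sum (d n : ℕ) :
    sumDegrees d n = ∑ k ∈ range (n + 1), k * (degreeEq d k).card := by
  rw [sumDegrees, sum_exponent]
  refine sum_congr rfl fun k _ => ?_
  rw [sum_congr rfl fun α hα => mem_degreeEq.1 hα, sum_const, smul_eq_mul, mul_comm]

lemma card_degreeEq_monotone (hd : 1 ≤ d) : Monotone fun k => (degreeEq d k).card := by
  refine monotone_nat_of_le_succ fun k => ?_
  refine card_le_card_of_injOn (fun α => α + Finsupp.single ⟨0, hd⟩ 1) (fun α hα => ?_)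
    (add_left_injective _).injOn
  rw [mem_coe, mem_degreeEq] at *
  simp [hα]

/-- Chebyshev's sum inequality: degrees and their multiplicities increase together, so the average
degree `l_n / m_n` is at least `n / 2`. -/
lemma mul_numMonomials_le (hd : 1 ≤ d) (n : ℕ) :
    n * numMonomials d n ≤ 2 * sumDegrees d n := by
  have h : (∑ k ∈ range (n + 1), k) * ∑ k ∈ range (n + 1), (degreeEq d k).card ≤
      (range (n + 1)).card * ∑ k ∈ range (n + 1), k * (degreeEq d k).card :=
    MonovaryOn.sum_mul_sum_le_card_mul_sum
      ((monotone_id.monovary (card_degreeEq_monotone hd)).monovaryOn _)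
  rw [← numMonomials_eq_sum, ← sumDegrees_eq_sum, card_range] at h
  have hg := sum_range_id_mul_two (n + 1)
  rw [Nat.add_sub_cancel] at hg
  refine Nat.le_of_mul_le_mul_left ?_ n.succ_pos
  calc (n + 1) * (n * numMonomials d n) = (∑ k ∈ range (n + 1), k) * numMonomials d n * 2 := by
        rw [← mul_assoc, ← hg]; ring
    _ ≤ (n + 1) * sumDegrees d n * 2 := Nat.mul_le_mul_right 2 h
    _ = (n + 1) * (2 * sumDegrees d n) := by ring

lemma numMonomials_le (d n : ℕ) : numMonomials d n ≤ (n + 1) ^ d := by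
  have h : numMonomials d n ≤ (Fintype.piFinset fun _ : Fin d => range (n + 1)).card := by
    refine card_le_card_of_injOn (fun a => ⇑(ofDegLex a)) (fun a ha => ?_)
      (fun a _ b _ h => ofDegLex_injective (DFunLike.coe_injective h))
    rw [mem_coe, Fintype.mem_piFinset]
    intro i
    rw [mem_coe, mem_multiIndices] at ha
    exact mem_range.2 (Nat.lt_succ_of_le ((Finsupp.le_degree i _).trans ha))
  simpa using h

lemma numMonomials_pos (d n : ℕ) : 0 < numMonomials d n :=
  card_pos.2 ⟨toDegLex 0, mem_multiIndices.2 (by simp)⟩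

lemma sumDegrees_pos (hd : 1 ≤ d) {n : ℕ} (hn : 1 ≤ n) : 0 < sumDegrees d n := by
  have := mul_numMonomials_le hd n
  have := Nat.mul_pos hn (numMonomials_pos d n)
  omega

/-! ### Asymptotics of the diameters -/

lemma nthDiam_mono {K' : Set (Fin d → ℂ)} (h : K ⊆ K') (hK' : IsCompact K') (n : ℕ) :
    nthDiam n K ≤ nthDiam n K' :=
  Real.rpow_le_rpow (maxVdm_nonneg n K) (maxVdm_mono h hK' n) (by positivity)

lemma prod_chebyshev_exponent (hd : 1 ≤ d) (K : Set (Fin d → ℂ)) (n : ℕ) :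
    ∏ i, chebyshev K (exponent d n i) =
      ∏ k ∈ range (n + 1), degreeMean (chebyshev K) k ^ (degreeEq d k).card := by
  rw [prod_exponent]
  exact prod_congr rfl fun k _ => (degreeMean_pow hd (fun _ => chebyshev_nonneg) k).symm

lemma prod_pow_card_degreeEq (a : ℝ) (n : ℕ) :
    ∏ k ∈ range (n + 1), (a ^ k) ^ (degreeEq d k).card = a ^ sumDegrees d n := by
  simp_rw [← pow_mul]
  rw [prod_pow_eq_pow_sum, sumDegrees_eq_sum]

/-- The infimum over `k ≥ 1` of the `k`-th roots of the geometric means of the Chebyshev constants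
in degree `k`. -/
noncomputable def chebyshevInf (K : Set (Fin d → ℂ)) : ℝ :=
  ⨅ k : ℕ, degreeMean (chebyshev K) (k + 1) ^ (1 / ((k + 1 : ℕ) : ℝ))

lemma chebyshevInf_nonneg : 0 ≤ chebyshevInf K :=
  Real.iInf_nonneg fun _ => Real.rpow_nonneg (degreeMean_nonneg (fun _ => chebyshev_nonneg) _) _

lemma chebyshevInf_pow_le {k : ℕ} (hk : k ≠ 0) :
    chebyshevInf K ^ k ≤ degreeMean (chebyshev K) k := by
  have h0 := fun k => degreeMean_nonneg (T := chebyshev K) (fun _ => chebyshev_nonneg) k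
  obtain ⟨k, rfl⟩ := Nat.exists_eq_succ_of_ne_zero hk
  have h : chebyshevInf K ≤ degreeMean (chebyshev K) (k + 1) ^ (1 / ((k + 1 : ℕ) : ℝ)) :=
    ciInf_le ⟨0, by rintro _ ⟨k, rfl⟩; exact Real.rpow_nonneg (h0 _) _⟩ k
  refine (pow_le_pow_left₀ chebyshevInf_nonneg h _).trans_eq ?_
  rw [one_div, Real.rpow_inv_natCast_pow (h0 _) hk]

lemma chebyshevInf_le_nthDiam (hd : 1 ≤ d) (hK : IsCompact K) {n : ℕ} (hn : 1 ≤ n) :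
    chebyshevInf K ≤ nthDiam n K := by
  have h0 := fun k => degreeMean_nonneg (T := chebyshev K) (fun _ => chebyshev_nonneg) k
  have hadd := degreeMean_add_le (T := chebyshev K) hd (fun _ => chebyshev_nonneg) (chebyshev_add_le hK)
  -- `chebyshevInf` carries no information on degree 0. If `G 0 < 1`, which happens only for empty
  -- `K`, then `G 1 ≤ G 1 * G 0` forces `G 1 = 0`.
  by_cases h1 : 1 ≤ degreeMean (chebyshev K) 0
  · have hV : chebyshevInf K ^ sumDegrees d n ≤ maxVdm n K := by
      refine le_trans ?_ (prod_chebyshev_le_maxVdm hK n)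
      rw [prod_chebyshev_exponent hd, ← prod_pow_card_degreeEq]
      refine prod_le_prod (fun k _ => pow_nonneg (pow_nonneg chebyshevInf_nonneg _) _)
        fun k _ => pow_le_pow_left₀ (pow_nonneg chebyshevInf_nonneg _) ?_ _
      rcases eq_or_ne k 0 with rfl | hk
      · simpa using h1
      · exact chebyshevInf_pow_le hk
    rw [nthDiam, one_div, ← Real.pow_rpow_inv_natCast chebyshevInf_nonneg
      (sumDegrees_pos hd hn).ne']
    exact Real.rpow_le_rpow (pow_nonneg chebyshevInf_nonneg _) hV (by positivity)
  · have h := hadd 1 0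
    rw [add_zero] at h
    have h' := chebyshevInf_pow_le (K := K) one_ne_zero
    rw [pow_one] at h'
    push Not at h1
    have : chebyshevInf K ≤ 0 := by
      refine h'.trans ?_
      nlinarith [h0 1]
    exact this.trans (Real.rpow_nonneg (maxVdm_nonneg n K) _)

lemma tendsto_rpow_two_div (d : ℕ) {M : ℝ} (hM : 1 ≤ M) :
    Tendsto (fun n : ℕ => (((n : ℝ) + 1) ^ d * M) ^ (2 / (n : ℝ))) atTop (𝓝 1) := by
  have h1 : Tendsto (fun n : ℕ => ((n : ℝ) + 1) ^ (2 / (n : ℝ))) atTop (𝓝 1) := by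
    -- At `x = n + 1` the exponent `2 / (1 * x + (-1))` is `2 / n`.
    have h := (tendsto_rpow_div_mul_add 2 1 (-1) zero_ne_one).comp
      (tendsto_atTop_add_const_right atTop (1 : ℝ) tendsto_natCast_atTop_atTop)
    refine h.congr fun n => ?_
    simp only [Function.comp_apply]
    congr 2
    ring
  have h2 : Tendsto (fun n : ℕ => M ^ (2 / (n : ℝ))) atTop (𝓝 1) := by
    have h := (tendsto_const_nhds (x := M)).rpow (tendsto_const_div_atTop_nhds_zero_nat (2 : ℝ))
      (Or.inl (by positivity))
    rwa [Real.rpow_zero] at h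
  have h3 := (h1.pow d).mul h2
  rw [one_pow, one_mul] at h3
  refine h3.congr fun n => ?_
  have hn : (0 : ℝ) ≤ (n : ℝ) + 1 := by positivity
  rw [Real.mul_rpow (by positivity) (by positivity), ← Real.rpow_natCast, ← Real.rpow_mul hn,
    ← Real.rpow_natCast (_ + 1), ← Real.rpow_mul hn, mul_comm (d : ℝ)]

/-- One good degree `k` gives `G n ≤ M * a ^ n` for all `n`. The factorial and the powers of `M`
together cost at most `((n + 1) ^ d * M) ^ m_n`, whose `l_n`-th root tends to 1. -/
lemma eventually_nthDiam_lt (hd : 1 ≤ d) (hK : IsCompact K) {a b : ℝ} (ha : 0 < a) (hab : a < b)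
    {k : ℕ} (hk : 0 < k) (hak : degreeMean (chebyshev K) k ≤ a ^ k) :
    ∀ᶠ n in atTop, nthDiam n K < b := by
  obtain ⟨R, hR, hKR⟩ := exists_norm_le_of_isCompact hK
  obtain ⟨M, hM, hMn⟩ := exists_degreeMean_le (T := chebyshev K) hd (fun _ => chebyshev_nonneg) (chebyshev_add_le hK)
    (fun α => chebyshev_le_of_mem (pow_mem_chebyshevBounds hR hKR α)) hR ha hk hak
  have hM0 : 0 ≤ M := by positivity
  have hlim := (tendsto_rpow_two_div d hM).mul_const a
  rw [one_mul] at hlim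
  filter_upwards [hlim.eventually_lt_const hab, eventually_ge_atTop 1] with n hn hn1
  refine lt_of_le_of_lt ?_ hn
  set X : ℝ := ((n : ℝ) + 1) ^ d * M
  have hX : 1 ≤ X := one_le_mul_of_one_le_of_one_le
    (one_le_pow₀ (le_add_of_nonneg_left (Nat.cast_nonneg n))) hM
  have hX0 : 0 ≤ X := by positivity
  have hl : 0 < sumDegrees d n := sumDegrees_pos hd hn1
  have hV : maxVdm n K ≤ X ^ numMonomials d n * a ^ sumDegrees d n := by
    refine (maxVdm_le hK n).trans ?_
    have hT : ∏ i, chebyshev K (exponent d n i) ≤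
        M ^ numMonomials d n * a ^ sumDegrees d n := by
      rw [prod_chebyshev_exponent hd, ← prod_pow_card_degreeEq, numMonomials_eq_sum,
        ← prod_pow_eq_pow_sum, ← prod_mul_distrib]
      refine prod_le_prod (fun k _ => pow_nonneg
        (degreeMean_nonneg (fun _ => chebyshev_nonneg) _) _) fun k _ => ?_
      rw [← mul_pow]
      exact pow_le_pow_left₀ (degreeMean_nonneg (fun _ => chebyshev_nonneg) _) (hMn k) _
    have hfac : ((numMonomials d n).factorial : ℝ) ≤ (((n : ℝ) + 1) ^ d) ^ numMonomials d n := by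
      refine le_trans (b := ((numMonomials d n : ℝ)) ^ numMonomials d n) ?_ ?_
      · exact_mod_cast Nat.factorial_le_pow _
      · refine pow_le_pow_left₀ (Nat.cast_nonneg _) ?_ _
        exact_mod_cast numMonomials_le d n
    calc _ ≤ (((n : ℝ) + 1) ^ d) ^ numMonomials d n *
          (M ^ numMonomials d n * a ^ sumDegrees d n) :=
          mul_le_mul hfac hT (prod_nonneg fun _ _ => chebyshev_nonneg) (by positivity)
      _ = X ^ numMonomials d n * a ^ sumDegrees d n := by rw [mul_pow, mul_assoc]
  calc nthDiam n K ≤ (X ^ numMonomials d n * a ^ sumDegrees d n) ^ (1 / (sumDegrees d n : ℝ)) :=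
        Real.rpow_le_rpow (maxVdm_nonneg n K) hV (by positivity)
    _ = X ^ ((numMonomials d n : ℝ) / sumDegrees d n) * a := by
        rw [Real.mul_rpow (by positivity) (by positivity), one_div,
          Real.pow_rpow_inv_natCast ha.le hl.ne', ← Real.rpow_natCast, ← Real.rpow_mul hX0,
          div_eq_mul_inv]
    _ ≤ X ^ (2 / (n : ℝ)) * a := by
        refine mul_le_mul_of_nonneg_right (Real.rpow_le_rpow_of_exponent_le hX ?_) ha.le
        have hl' : (0 : ℝ) < sumDegrees d n := by exact_mod_cast hl
        have hn' : (0 : ℝ) < n := by exact_mod_cast hn1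
        rw [div_le_div_iff₀ hl' hn', mul_comm]
        exact_mod_cast mul_numMonomials_le hd n

/-- The diameters of a decreasing sequence of compact sets converge to the invariant
`chebyshevInf` of the intersection. -/
lemma tendsto_nthDiam (hd : 1 ≤ d) {Kseq : ℕ → Set (Fin d → ℂ)}
    (hcompact : ∀ n, IsCompact (Kseq n)) (hanti : Antitone Kseq) :
    Tendsto (fun n => nthDiam n (Kseq n)) atTop (𝓝 (chebyshevInf (⋂ n, Kseq n))) := by
  have hK : IsCompact (⋂ n, Kseq n) :=
    (hcompact 0).of_isClosed_subset (isClosed_iInter fun n => (hcompact n).isClosed)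
      (Set.iInter_subset _ 0)
  refine tendsto_order.2 ⟨fun b hb => ?_, fun b hb => ?_⟩
  · filter_upwards [eventually_ge_atTop 1] with n hn
    exact hb.trans_le ((chebyshevInf_le_nthDiam hd hK hn).trans
      (nthDiam_mono (Set.iInter_subset _ n) (hcompact n) n))
  · obtain ⟨a, ha, hab⟩ := exists_between hb
    have ha0 : 0 < a := chebyshevInf_nonneg.trans_lt ha
    obtain ⟨k, hk⟩ := exists_lt_of_ciInf_lt ha
    have hT0 := degreeMean_nonneg (T := chebyshev (⋂ n, Kseq n)) (fun _ => chebyshev_nonneg) (k + 1)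
    have hka : degreeMean (chebyshev (⋂ n, Kseq n)) (k + 1) < a ^ (k + 1) := by
      have h := pow_lt_pow_left₀ hk (Real.rpow_nonneg hT0 _) k.succ_ne_zero
      rwa [one_div, Nat.succ_eq_add_one, Real.rpow_inv_natCast_pow hT0 k.succ_ne_zero] at h
    have hlim : Tendsto (fun m => degreeMean (chebyshev (Kseq m)) (k + 1)) atTop
        (𝓝 (degreeMean (chebyshev (⋂ n, Kseq n)) (k + 1))) :=
      (tendsto_finsetProd _ fun α _ => tendsto_chebyshev hcompact hanti α).rpow_const
        (Or.inr (by positivity))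
    obtain ⟨m, hm⟩ := (hlim.eventually_lt_const hka).exists
    filter_upwards [eventually_nthDiam_lt hd (hcompact m) ha0 hab k.succ_pos hm.le,
      eventually_ge_atTop m] with n hn hmn
    exact (nthDiam_mono (hanti hmn) (hcompact m) n).trans_lt hn

end PluriPot

theorem proposition4 {d : ℕ} (hd : 1 ≤ d) (K : Set (Fin d → ℂ)) (hK : IsCompact K)
    (hKpp : ¬ PluriPot.IsPluripolar K)
    (Kseq : ℕ → Set (Fin d → ℂ)) (hcompact : ∀ n, IsCompact (Kseq n))
    (hdecr : ∀ n, Kseq (n + 1) ⊆ Kseq n) (hinter : K = ⋂ n, Kseq n) :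
    Filter.Tendsto (fun n => PluriPot.nthDiam n K) Filter.atTop
        (nhds (PluriPot.transfiniteDiameter K)) ∧
      Filter.Tendsto (fun n => PluriPot.nthDiam n (Kseq n)) Filter.atTop
        (nhds (PluriPot.transfiniteDiameter K)) := by
  have hlim : Tendsto (fun n => PluriPot.nthDiam n K) atTop (𝓝 (PluriPot.chebyshevInf K)) := by
    -- The constant sequence gives existence of the limit for `K` itself.
    have h := PluriPot.tendsto_nthDiam hd (Kseq := fun _ => K) (fun _ => hK) antitone_const
    rwa [Set.iInter_const] at h
  have hδ : PluriPot.transfiniteDiameter K = PluriPot.chebyshevInf K := hlim.limUnder_eq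
  rw [hδ]
  refine ⟨hlim, ?_⟩
  rw [hinter]
  exact PluriPot.tendsto_nthDiam hd hcompact (antitone_nat_of_succ_le hdecr)
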